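/- Let $X$ be a completely regular Hausdorff topological space and let $\psi\colon X\to(0,\infty)$ be an admissible weight function, that is, the sets $\{x\in X : \psi(x)\le R\}$ are compact for all $R>0$. Let $\mathrm{B}^\psi(X)$ be the space of all functions $f\colon X\to\mathbb{R}$ with $\lVert f\rVert_\psi:=\sup_{x\in X}\psi(x)^{-1}\lvert f(x)\rvert<\infty$, normed by $\lVert\cdot\rVert_\psi$, and let $\mathcal{B}^\psi(X)$ be the closure in $\mathrm{B}^\psi(X)$ of the space $\mathrm{C}_b(X)$ of bounded continuous real functions on $X$. Let $\ell\colon\mathcal{B}^\psi(X)\to\mathbb{R}$ be a continuous linear functional. Then there exists a finite signed Radon measure $\mu$ on $X$ (a finite signed Borel measure whose total variation measure $\lvert\mu\rvert$ is inner regular with respect to compact sets) such that every $f\in\mathcal{B}^\psi(X)$ is $\lvert\mu\rvert$-integrable and $$\ell(f)=\int_X f(x)\,\mu(\mathrm{d}x)\quad\text{for all } f\in\mathcal{B}^\psi(X).$$ Furthermore, $\psi$ is $\lvert\mu\rvert$-integrable and $$\int_X\psi(x)\,\lvert\mu\rvert(\mathrm{d}x)=\lVert\ell\rVert,$$ where $\lVert\ell\rVert$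 is the operator norm of $\ell$ with respect to $\lVert\cdot\rVert_\psi$. -/

import Mathlib

open MeasureTheory

noncomputable section

/-- An admissible weight function on `X`: a function `ψ : X → (0, ∞)` all of whose sublevel sets
`{x | ψ x ≤ R}`, `R > 0`, are compact. -/
structure AdmissibleWeight (X : Type*) [TopologicalSpace X] where
  /-- The underlying function. -/
  toFun : X → ℝ
  pos : ∀ x, 0 < toFun x
  isCompact_sublevel : ∀ R : ℝ, 0 < R → IsCompact {x | toFun x ≤ R}

namespace AdmissibleWeight

variable {X : Type*} [TopologicalSpace X]

instance : CoeFun (AdmissibleWeight X) (fun _ => X → ℝ) := ⟨AdmissibleWeight.toFun⟩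

/-- The real functions `f` on `X` with `sup_x ψ(x)⁻¹ |f(x)| < ∞`, as a linear subspace of all
functions. -/
def boundedSubmodule (ψ : AdmissibleWeight X) : Submodule ℝ (X → ℝ) where
  carrier := {f | BddAbove (Set.range fun x => (ψ x)⁻¹ * |f x|)}
  zero_mem' := ⟨0, by rintro _ ⟨x, rfl⟩; simp⟩
  add_mem' := by
    rintro f g ⟨a, ha⟩ ⟨b, hb⟩
    refine ⟨a + b, ?_⟩
    rintro _ ⟨x, rfl⟩
    have h1 := ha ⟨x, rfl⟩
    have h2 := hb ⟨x, rfl⟩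
    have h3 := mul_le_mul_of_nonneg_left (abs_add_le (f x) (g x)) (inv_pos.2 (ψ.pos x)).le
    simp only [Pi.add_apply] at h1 h2 h3 ⊢
    linarith
  smul_mem' := by
    rintro c f ⟨a, ha⟩
    refine ⟨|c| * a, ?_⟩
    rintro _ ⟨x, rfl⟩
    have h1 := mul_le_mul_of_nonneg_left (ha ⟨x, rfl⟩) (abs_nonneg c)
    simp only [Pi.smul_apply, smul_eq_mul, abs_mul] at h1 ⊢
    linarith

/-- The space `B^ψ(X)` of all real functions `f` on `X` with `sup_x ψ(x)⁻¹ |f(x)| < ∞`. It is a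
type of its own because it carries the topology of the weighted norm, not the pointwise one. -/
def WeightedBounded (ψ : AdmissibleWeight X) : Type _ := ψ.boundedSubmodule

namespace WeightedBounded

variable {ψ : AdmissibleWeight X}

instance : AddCommGroup (WeightedBounded ψ) :=
  inferInstanceAs (AddCommGroup ψ.boundedSubmodule)

instance : Module ℝ (WeightedBounded ψ) :=
  inferInstanceAs (Module ℝ ψ.boundedSubmodule)

instance : CoeFun (WeightedBounded ψ) (fun _ => X → ℝ) := ⟨fun f => f.1⟩

/-- The weighted supremum norm `‖f‖_ψ = sup_x ψ(x)⁻¹ |f(x)|`. -/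
instance : Norm (WeightedBounded ψ) := ⟨fun f => ⨆ x, (ψ x)⁻¹ * |f x|⟩

theorem norm_def (f : WeightedBounded ψ) : ‖f‖ = ⨆ x, (ψ x)⁻¹ * |f x| := rfl

theorem le_norm (f : WeightedBounded ψ) (x : X) : (ψ x)⁻¹ * |f x| ≤ ‖f‖ :=
  le_ciSup f.2 x

theorem norm_nonneg' (f : WeightedBounded ψ) : 0 ≤ ‖f‖ :=
  Real.iSup_nonneg fun x => mul_nonneg (inv_pos.2 (ψ.pos x)).le (abs_nonneg _)

theorem core : NormedSpace.Core ℝ (WeightedBounded ψ) where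
  norm_nonneg := norm_nonneg'
  norm_smul c f := by
    rw [norm_def, norm_def, Real.norm_eq_abs, Real.mul_iSup_of_nonneg (abs_nonneg c)]
    refine iSup_congr fun x => ?_
    change (ψ x)⁻¹ * |c * f x| = _
    rw [abs_mul]
    ring
  norm_triangle f g := by
    refine Real.iSup_le (fun x => ?_) (add_nonneg (norm_nonneg' f) (norm_nonneg' g))
    have h1 := le_norm f x
    have h2 := le_norm g x
    have h3 := mul_le_mul_of_nonneg_left (abs_add_le (f x) (g x)) (inv_pos.2 (ψ.pos x)).le
    change (ψ x)⁻¹ * |f x + g x| ≤ _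
    linarith
  norm_eq_zero_iff f := by
    constructor
    · intro h
      refine Subtype.ext (funext fun x => ?_)
      have h1 := le_norm f x
      rw [h] at h1
      have h2 : |f x| ≤ 0 := by
        by_contra h3
        exact absurd h1 (not_le.2 (mul_pos (inv_pos.2 (ψ.pos x)) (not_le.1 h3)))
      exact abs_nonpos_iff.1 h2
    · rintro rfl
      have h : ∀ x : X, (ψ x)⁻¹ * |(0 : WeightedBounded ψ) x| = 0 := fun x => by
        change (ψ x)⁻¹ * |(0 : ℝ)| = 0
        simp
      rw [norm_def]
      simp only [h]
      exact Real.iSup_const_zero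

instance : NormedAddCommGroup (WeightedBounded ψ) := NormedAddCommGroup.ofCore core

instance : NormedSpace ℝ (WeightedBounded ψ) := NormedSpace.ofCore core

end WeightedBounded

/-- An admissible weight is bounded away from zero. -/
theorem exists_pos_le (ψ : AdmissibleWeight X) [T2Space X] : ∃ c : ℝ, 0 < c ∧ ∀ x, c ≤ ψ x := by
  have hlsc : LowerSemicontinuous (fun x => ψ x) := by
    rw [lowerSemicontinuous_iff_isClosed_preimage]
    intro R
    rcases le_or_gt R 0 with hR | hR
    · have : (fun x => ψ x) ⁻¹' Set.Iic R = ∅ :=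
        Set.eq_empty_of_forall_notMem fun x hx => absurd (le_trans hx hR) (not_le.2 (ψ.pos x))
      rw [this]
      exact isClosed_empty
    · exact (ψ.isCompact_sublevel R hR).isClosed
  rcases Set.eq_empty_or_nonempty {x | ψ x ≤ 1} with he | hne
  · exact ⟨1, one_pos, fun x => le_of_lt (not_le.1 fun h =>
      (Set.eq_empty_iff_forall_notMem.1 he x) h)⟩
  · obtain ⟨a, ha, hmin⟩ := (hlsc.lowerSemicontinuousOn _).exists_isMinOn hne
      (ψ.isCompact_sublevel 1 one_pos)
    refine ⟨ψ a, ψ.pos a, fun x => ?_⟩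
    rcases le_or_gt (ψ x) 1 with h | h
    · exact hmin h
    · exact le_trans ha h.le

/-- The inclusion `C_b(X) ⊆ B^ψ(X)`. -/
def ofBoundedContinuous (ψ : AdmissibleWeight X) [T2Space X] :
    BoundedContinuousFunction X ℝ →ₗ[ℝ] WeightedBounded ψ where
  toFun g := ⟨fun x => g x, by
    obtain ⟨c, hc, hψ⟩ := ψ.exists_pos_le
    refine ⟨c⁻¹ * ‖g‖, ?_⟩
    rintro _ ⟨x, rfl⟩
    exact mul_le_mul (inv_anti₀ hc (hψ x)) (g.norm_coe_le_norm x) (abs_nonneg _)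
      (inv_pos.2 hc).le⟩
  map_add' _ _ := rfl
  map_smul' _ _ := rfl

/-- The space `𝓑^ψ(X)` of functions with growth controlled by `ψ`: the closure of `C_b(X)` in
`B^ψ(X)` for the norm `‖·‖_ψ`. It is a normed space with the restriction of this norm. -/
def controlledGrowth (ψ : AdmissibleWeight X) [T2Space X] : Submodule ℝ (WeightedBounded ψ) :=
  (LinearMap.range ψ.ofBoundedContinuous).topologicalClosure

end AdmissibleWeight

/-- A (finite) signed Borel measure is Radon if its total variation measure is inner regular with
respect to compact sets. -/
def IsSignedRadon {X : Type*} [TopologicalSpace X] [MeasurableSpace X] (μ : SignedMeasure X) :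
    Prop :=
  μ.totalVariation.InnerRegular

end

/-! Pass to the Stone–Čech compactification, pull ℓ back to `C(βX, ℝ≥0)`, and split it into positive
and negative parts, each a measure by Riesz–Markov–Kakutani. Extended by ∞ off X, ψ is lower
semicontinuous. Any continuous f ≥ 0 below it has total mass at most ‖ℓ‖: this mass is a supremum of
ℓ(g - g') with g, g' in [0, f], where |g - g'| ≤ ψ. Approximation from below then bounds the
integral of the extended weight by ‖ℓ‖ (`exists_regular_pair`), so the measures do not charge βX \ X
and descend to Radon measures μ₁, μ₂ on X (`exists_innerRegular_pair`).

With μ = μ₁ - μ₂, both functionals agree on C_b(X), hence on its closure. The norm identity needs no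
minimality of the pair: |μ| ≤ μ₁ + μ₂ gives ∫ψ d|μ| ≤ ‖ℓ‖, and |∫f dμ| ≤ ‖f‖ ∫ψ d|μ| gives the
converse. -/

open Filter Topology Set
open scoped ENNReal NNReal CompactlySupported

noncomputable section

/-! ### Jordan decomposition of order bounded functionals -/

section PosPart

variable {K : Type*} [TopologicalSpace K]

/-- The values of a functional on the order interval `[0, f]` are bounded above. -/
def OrderBoundedAbove (T : C(K, ℝ≥0) →ₗ[ℝ≥0] ℝ) : Prop := ∀ f, BddAbove (T '' Set.Iic f)

/-- The supremum of a functional over the order interval `[0, f]`. -/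
def intervalSup (T : C(K, ℝ≥0) →ₗ[ℝ≥0] ℝ) (f : C(K, ℝ≥0)) : ℝ := sSup (T '' Set.Iic f)

variable {T : C(K, ℝ≥0) →ₗ[ℝ≥0] ℝ}

theorem OrderBoundedAbove.le_intervalSup (hT : OrderBoundedAbove T) {f g : C(K, ℝ≥0)}
    (h : g ≤ f) : T g ≤ intervalSup T f :=
  le_csSup (hT f) ⟨g, h, rfl⟩

theorem intervalSup_le {f : C(K, ℝ≥0)} {a : ℝ} (h : ∀ g ≤ f, T g ≤ a) : intervalSup T f ≤ a :=
  csSup_le ⟨T f, f, le_refl f, rfl⟩ (by rintro _ ⟨g, hg, rfl⟩; exact h g hg)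

theorem zero_le_continuousMap_nnreal (f : C(K, ℝ≥0)) : 0 ≤ f := fun _ => zero_le

theorem OrderBoundedAbove.intervalSup_nonneg (hT : OrderBoundedAbove T) (f : C(K, ℝ≥0)) :
    0 ≤ intervalSup T f := by
  simpa using hT.le_intervalSup (zero_le_continuousMap_nnreal f)

/-- The Riesz decomposition property of `C(K, ℝ≥0)`. -/
theorem exists_add_eq_of_le_add {f₁ f₂ g : C(K, ℝ≥0)} (h : g ≤ f₁ + f₂) :
    ∃ g₁ ≤ f₁, ∃ g₂ ≤ f₂, g₁ + g₂ = g := by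
  refine ⟨g ⊓ f₁, inf_le_right, g - f₁, fun x => ?_, ?_⟩
  · have := h x
    simpa [tsub_le_iff_left, add_comm] using this
  · ext x
    have : min (g x) (f₁ x) + (g x - f₁ x) = g x := by
      rcases le_total (g x) (f₁ x) with hx | hx
      · simp [hx, tsub_eq_zero_of_le]
      · simp [hx, add_tsub_cancel_of_le]
    exact congrArg NNReal.toReal this

theorem OrderBoundedAbove.intervalSup_add (hT : OrderBoundedAbove T) (f₁ f₂ : C(K, ℝ≥0)) :
    intervalSup T (f₁ + f₂) = intervalSup T f₁ + intervalSup T f₂ := by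
  apply le_antisymm
  · refine intervalSup_le fun g hg => ?_
    obtain ⟨g₁, h₁, g₂, h₂, rfl⟩ := exists_add_eq_of_le_add hg
    rw [map_add]
    exact add_le_add (hT.le_intervalSup h₁) (hT.le_intervalSup h₂)
  · rw [← le_sub_iff_add_le]
    refine intervalSup_le fun g₁ h₁ => ?_
    rw [le_sub_comm]
    refine intervalSup_le fun g₂ h₂ => ?_
    rw [le_sub_iff_add_le', ← map_add]
    exact hT.le_intervalSup (add_le_add h₁ h₂)

theorem OrderBoundedAbove.intervalSup_smul_le (hT : OrderBoundedAbove T) (c : ℝ≥0)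
    (f : C(K, ℝ≥0)) : c * intervalSup T f ≤ intervalSup T (c • f) := by
  rcases eq_or_ne c 0 with rfl | hc
  · simpa using hT.intervalSup_nonneg _
  · have hc' : (0 : ℝ) < c := by positivity
    rw [← le_div_iff₀' hc']
    refine intervalSup_le fun g hg => ?_
    rw [le_div_iff₀' hc']
    have : (c : ℝ) * T g = T (c • g) := by rw [map_smul]; rfl
    rw [this]
    refine hT.le_intervalSup fun x => ?_
    exact mul_le_mul_right (hg x) c

theorem OrderBoundedAbove.intervalSup_smul (hT : OrderBoundedAbove T) (c : ℝ≥0)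
    (f : C(K, ℝ≥0)) : intervalSup T (c • f) = c * intervalSup T f := by
  refine le_antisymm ?_ (hT.intervalSup_smul_le c f)
  rcases eq_or_ne c 0 with rfl | hc
  · refine intervalSup_le fun g hg => ?_
    have : g = 0 := le_antisymm (by simpa using hg) (zero_le_continuousMap_nnreal g)
    simp [this]
  -- The reverse inequality is the same one for the scalar c⁻¹ and the function c • f.
  · have := hT.intervalSup_smul_le c⁻¹ (c • f)
    rw [smul_smul, inv_mul_cancel₀ hc, one_smul, NNReal.coe_inv] at this
    rwa [inv_mul_le_iff₀ (by positivity)] at this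

/-- The positive part of an order bounded functional. -/
def OrderBoundedAbove.posPart (hT : OrderBoundedAbove T) : C(K, ℝ≥0) →ₗ[ℝ≥0] ℝ≥0 where
  toFun f := ⟨intervalSup T f, hT.intervalSup_nonneg f⟩
  map_add' f g := NNReal.eq (hT.intervalSup_add f g)
  map_smul' c f := NNReal.eq (hT.intervalSup_smul c f)

theorem OrderBoundedAbove.coe_posPart (hT : OrderBoundedAbove T) (f : C(K, ℝ≥0)) :
    (hT.posPart f : ℝ) = intervalSup T f := rfl

/-- The reflection g ↦ f - g maps [0, f] onto itself, and T (f - g) = T f - T g. -/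
theorem intervalSup_sub_intervalSup_neg (hT : OrderBoundedAbove T) (hT' : OrderBoundedAbove (-T))
    (f : C(K, ℝ≥0)) : intervalSup T f - intervalSup (-T) f = T f := by
  have key : ∀ g ≤ f, T (f - g) = T f - T g := fun g hg => by
    rw [eq_sub_iff_add_eq, ← map_add]
    congr 1
    ext x
    exact congrArg NNReal.toReal (tsub_add_cancel_of_le (hg x))
  have hsub : ∀ g : C(K, ℝ≥0), f - g ≤ f := fun g x => tsub_le_self
  apply le_antisymm
  · rw [sub_le_iff_le_add]
    refine intervalSup_le fun g hg => ?_
    have := hT'.le_intervalSup (hsub g)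
    rw [LinearMap.neg_apply, key g hg] at this
    linarith
  · rw [le_sub_comm]
    refine intervalSup_le fun g hg => ?_
    have := hT.le_intervalSup (hsub g)
    rw [key g hg] at this
    rw [LinearMap.neg_apply]
    linarith

/-- The two suprema run independently over [0, f], so bounding differences bounds the total
variation. -/
theorem intervalSup_add_intervalSup_neg_le {f : C(K, ℝ≥0)} {a : ℝ}
    (h : ∀ g ≤ f, ∀ g' ≤ f, T g - T g' ≤ a) : intervalSup T f + intervalSup (-T) f ≤ a := by
  rw [← le_sub_iff_add_le]
  refine intervalSup_le fun g hg => ?_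
  rw [le_sub_comm]
  refine intervalSup_le fun g' hg' => ?_
  have := h g hg g' hg'
  rw [LinearMap.neg_apply]
  linarith

end PosPart

/-! ### Measures on a compact space and lower semicontinuous integrands -/

/-- The Riesz–Markov–Kakutani theorem on a compact space, for functionals on `C(K, ℝ≥0)`. -/
theorem exists_regular_lintegral_eq {K : Type*} [TopologicalSpace K] [CompactSpace K] [T2Space K]
    [MeasurableSpace K] [BorelSpace K] (p : C(K, ℝ≥0) →ₗ[ℝ≥0] ℝ≥0) :
    ∃ ν : Measure K, ν.Regular ∧ IsFiniteMeasure ν ∧ ∀ f : C(K, ℝ≥0), ∫⁻ x, f x ∂ν = p f := by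
  let Λ : C_c(K, ℝ≥0) →ₗ[ℝ≥0] ℝ≥0 :=
    { toFun := fun f => p f.toContinuousMap
      map_add' := fun f g => p.map_add _ _
      map_smul' := fun c f => p.map_smul _ _ }
  refine ⟨NNRealRMK.rieszMeasure Λ, inferInstance, inferInstance, fun f => ?_⟩
  exact NNRealRMK.lintegral_rieszMeasure Λ (CompactlySupportedContinuousMap.continuousMapEquiv f)

section Semicontinuous

variable {K : Type*} [TopologicalSpace K]

/-- Strict insertion of a continuous function between semicontinuous ones. -/
theorem exists_continuous_between_of_lt [CompactSpace K] [T2Space K] {g : K → ℝ≥0} {h : K → ℝ≥0∞}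
    (hg : UpperSemicontinuous g) (hh : LowerSemicontinuous h) (hlt : ∀ x, (g x : ℝ≥0∞) < h x) :
    ∃ f : C(K, ℝ≥0), (∀ x, g x ≤ f x) ∧ ∀ x, (f x : ℝ≥0∞) ≤ h x := by
  obtain ⟨f, hf⟩ := exists_continuous_forall_mem_convex_of_local_const
    (t := fun x => {r : ℝ | (g x : ℝ) ≤ r ∧ ENNReal.ofReal r ≤ h x}) (fun x => by
      refine Set.OrdConnected.convex ⟨?_⟩
      rintro a ⟨ha, _⟩ b ⟨_, hb⟩ c ⟨hac, hcb⟩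
      exact ⟨ha.trans hac, (ENNReal.ofReal_le_ofReal hcb).trans hb⟩) (fun x => by
      obtain ⟨c, hgc, hch⟩ := ENNReal.lt_iff_exists_nnreal_btwn.1 (hlt x)
      refine ⟨c, ?_⟩
      filter_upwards [hg x c (by exact_mod_cast hgc), hh x c hch] with y hy hy'
      refine ⟨by exact_mod_cast hy.le, ?_⟩
      simpa using hy'.le)
  refine ⟨⟨fun x => (f x).toNNReal, by fun_prop⟩, fun x => ?_, fun x => (hf x).2⟩
  exact NNReal.le_toNNReal_of_coe_le (hf x).1

/-- For a regular measure, the integral of a positive lower semicontinuous function is determined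
by the continuous functions below it. -/
theorem lintegral_le_of_forall_continuous_le [CompactSpace K] [T2Space K] [MeasurableSpace K]
    [BorelSpace K] {ν : Measure K} [ν.Regular] [IsFiniteMeasure ν] {h : K → ℝ≥0∞}
    (hh : LowerSemicontinuous h) (hpos : ∀ x, 0 < h x) {B : ℝ≥0∞}
    (hB : ∀ f : C(K, ℝ≥0), (∀ x, (f x : ℝ≥0∞) ≤ h x) → ∫⁻ x, f x ∂ν ≤ B) :
    ∫⁻ x, h x ∂ν ≤ B := by
  rw [lintegral_eq_nnreal]
  refine iSup₂_le fun s hs => ?_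
  rw [← SimpleFunc.lintegral_eq_lintegral]
  simp only [SimpleFunc.map_apply]
  have hfin : ∫⁻ x, s x ∂ν ≠ ∞ := by
    obtain ⟨C, hC⟩ := s.exists_forall_le
    refine ((lintegral_mono (g := fun _ => (C : ℝ≥0∞))
      fun x => ENNReal.coe_le_coe.2 (hC x)).trans_lt ?_).ne
    rw [lintegral_const]
    exact ENNReal.mul_lt_top ENNReal.coe_lt_top (measure_lt_top _ _)
  refine ENNReal.le_of_forall_pos_le_add fun ε hε _ => ?_
  -- Vitali–Carathéodory: an upper semicontinuous g ≤ s loses at most ε of the integral.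
  obtain ⟨g, hgs, hg, hint⟩ := SimpleFunc.exists_upperSemicontinuous_le_lintegral_le s hfin
    (ENNReal.coe_ne_zero.2 hε.ne')
  refine hint.trans (add_le_add_left ?_ _)
  have hgh : ∀ x, (g x : ℝ≥0∞) ≤ h x := fun x => (ENNReal.coe_le_coe.2 (hgs x)).trans (hs x)
  -- Scaling by c < 1 makes g ≤ h strict, with `hpos` covering the zeros of g; a continuous function
  -- then fits in between.
  have step : ∀ c : ℝ≥0, c < 1 → (c : ℝ≥0∞) * ∫⁻ x, g x ∂ν ≤ B := fun c hc => by
    have hcg : UpperSemicontinuous fun x => c * g x :=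
      Continuous.comp_upperSemicontinuous (g := fun r : ℝ≥0 => c * r) (by fun_prop) hg
        (fun a b hab => mul_le_mul_right hab c)
    obtain ⟨f, hf₁, hf₂⟩ := exists_continuous_between_of_lt hcg hh fun x => by
      rcases eq_or_ne (g x) 0 with h0 | h0
      · simpa [h0] using hpos x
      · refine lt_of_lt_of_le ?_ (hgh x)
        exact_mod_cast mul_lt_of_lt_one_left (pos_iff_ne_zero.2 h0) hc
    rw [← lintegral_const_mul' _ _ ENNReal.coe_ne_top]
    refine (lintegral_mono fun x => ?_).trans (hB f hf₂)
    rw [← ENNReal.coe_mul]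
    exact ENNReal.coe_le_coe.2 (hf₁ x)
  have hlim : Tendsto (fun c : ℝ≥0 => (c : ℝ≥0∞) * ∫⁻ x, g x ∂ν) (𝓝[<] 1)
      (𝓝 ((1 : ℝ≥0) * ∫⁻ x, g x ∂ν)) := by
    refine ENNReal.Tendsto.mul_const ?_ (Or.inl (by simp))
    exact (ENNReal.continuous_coe.tendsto _).mono_left nhdsWithin_le_nhds
  rw [ENNReal.coe_one, one_mul] at hlim
  have : (𝓝[<] (1 : ℝ≥0)).NeBot := nhdsLT_neBot_of_exists_lt ⟨0, one_pos⟩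
  exact le_of_tendsto hlim (eventually_nhdsWithin_of_forall step)

end Semicontinuous

/-! ### Permanence of inner regularity -/

/-- A compact C ⊆ s with ν (s \ C) small also has μ (s \ C) small. This carries the Radon property
from μ₁ + μ₂ to |μ|. -/
theorem MeasureTheory.Measure.InnerRegular.of_le {X : Type*} [TopologicalSpace X] [T2Space X]
    [MeasurableSpace X] [BorelSpace X] {μ ν : Measure X} [IsFiniteMeasure ν] [ν.InnerRegular]
    (h : μ ≤ ν) : μ.InnerRegular := by
  refine ⟨fun s hs r hr => ?_⟩
  obtain ⟨C, hCs, hC, hlt⟩ := hs.exists_isCompact_lt_add (μ := ν) (measure_ne_top _ _)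
    (tsub_pos_iff_lt.2 hr).ne'
  refine ⟨C, hCs, hC, ?_⟩
  have h1 : μ (s \ C) < μ s - r := by
    refine (h _).trans_lt ?_
    rw [measure_sdiff hCs hC.measurableSet.nullMeasurableSet (measure_ne_top _ _)]
    exact ENNReal.sub_lt_of_lt_add (measure_mono hCs) (by rwa [add_comm] at hlt)
  have hμs : μ s ≠ ∞ := ((h s).trans_lt (measure_lt_top _ _)).ne
  by_contra hle
  rw [not_lt] at hle
  have h2 : μ s ≤ μ C + μ (s \ C) := by
    refine (measure_mono ?_).trans (measure_union_le C (s \ C))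
    rw [union_sdiff_self]
    exact subset_union_right
  have h3 : μ C + μ (s \ C) < r + (μ s - r) :=
    ENNReal.add_lt_add_of_le_of_lt (hle.trans_lt (hr.trans_le le_top)).ne hle h1
  rw [add_tsub_cancel_of_le hr.le] at h3
  exact absurd h2 (not_le.2 h3)

theorem Topology.IsEmbedding.innerRegular_comap {X K : Type*} [TopologicalSpace X]
    [TopologicalSpace K] [MeasurableSpace X] [BorelSpace X] [MeasurableSpace K] [BorelSpace K]
    {i : X → K} (hi : IsEmbedding i) (hr : MeasurableSet (range i)) (ν : Measure K)
    [ν.InnerRegular] : (ν.comap i).InnerRegular := by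
  refine ⟨fun s hs r hrs => ?_⟩
  have hm := hi.measurableEmbedding hr
  rw [hm.comap_apply] at hrs
  obtain ⟨C, hCs, hC, hlt⟩ := (hm.measurableSet_image.2 hs).exists_lt_isCompact hrs
  have hCr : C ⊆ range i := hCs.trans (image_subset_range _ _)
  refine ⟨i ⁻¹' C, fun x hx => ?_, hi.isInducing.isCompact_preimage' hC hCr, ?_⟩
  · obtain ⟨y, hy, hxy⟩ := hCs hx
    exact hi.injective hxy ▸ hy
  · rwa [hm.comap_apply, image_preimage_eq_of_subset hCr]

/-! ### The weight and the functional on a compactification -/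

namespace AdmissibleWeight

variable {X : Type*} [TopologicalSpace X] {ψ : AdmissibleWeight X}

theorem WeightedBounded.abs_apply_le (f : WeightedBounded ψ) (x : X) : |f x| ≤ ‖f‖ * ψ x := by
  have := f.le_norm x
  rwa [inv_mul_le_iff₀ (ψ.pos x), mul_comm] at this

theorem WeightedBounded.norm_le_of_forall_abs_le {f : WeightedBounded ψ} {c : ℝ} (hc : 0 ≤ c)
    (h : ∀ x, |f x| ≤ c * ψ x) : ‖f‖ ≤ c :=
  Real.iSup_le (fun x => by
    rw [inv_mul_le_iff₀ (ψ.pos x), mul_comm]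
    exact h x) hc

section Extension

variable {K : Type*} {i : X → K}

variable (ψ i) in
/-- The extension of a weight along `i` by `∞`. -/
def extendTop : K → ℝ≥0∞ := Function.extend i (fun x => ENNReal.ofReal (ψ x)) fun _ => ∞

theorem extendTop_apply (hi : Function.Injective i) (x : X) :
    ψ.extendTop i (i x) = ENNReal.ofReal (ψ x) := hi.extend_apply _ _ _

theorem extendTop_of_notMem {k : K} (hk : k ∉ range i) : ψ.extendTop i k = ∞ :=
  Function.extend_apply' _ _ _ fun ⟨x, hx⟩ => hk ⟨x, hx⟩

theorem extendTop_pos (hi : Function.Injective i) (k : K) : 0 < ψ.extendTop i k := by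
  by_cases hk : k ∈ range i
  · obtain ⟨x, rfl⟩ := hk
    rw [extendTop_apply hi]
    exact ENNReal.ofReal_pos.2 (ψ.pos x)
  · rw [extendTop_of_notMem hk]
    exact ENNReal.zero_lt_top

/-- Makes X a Borel subset of its compactification, and a conull one once the extended weight is
integrable. -/
theorem range_eq_extendTop_lt_top (hi : Function.Injective i) :
    range i = {k | ψ.extendTop i k < ∞} := by
  ext k
  by_cases hk : k ∈ range i
  · obtain ⟨x, rfl⟩ := hk
    simp [extendTop_apply hi]
  · simp [extendTop_of_notMem hk, hk]

/-- Sublevel sets at finite levels are images of compact sublevel sets of ψ, hence closed in K. -/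
theorem lowerSemicontinuous_extendTop [TopologicalSpace K] [T2Space K] (hi : Continuous i)
    (hinj : Function.Injective i) : LowerSemicontinuous (ψ.extendTop i) := by
  rw [lowerSemicontinuous_iff_isClosed_preimage]
  intro a
  rcases eq_or_ne a ∞ with rfl | ha
  · simp
  have : ψ.extendTop i ⁻¹' Iic a = i '' {x | ψ x ≤ a.toReal} := by
    ext k
    by_cases hk : k ∈ range i
    · obtain ⟨x, rfl⟩ := hk
      simp [extendTop_apply hinj, hinj.mem_set_image, ENNReal.ofReal_le_iff_le_toReal ha]
    · simp only [mem_preimage, extendTop_of_notMem hk, mem_Iic, top_le_iff, ha, false_iff]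
      exact fun h => hk (image_subset_range _ _ h)
  rw [this]
  rcases eq_or_lt_of_le (ENNReal.toReal_nonneg (a := a)) with h0 | h0
  · have : {x | ψ x ≤ a.toReal} = ∅ :=
      Set.eq_empty_of_forall_notMem fun x hx => absurd (hx.trans h0.ge) (not_le.2 (ψ.pos x))
    simp [this]
  · exact ((ψ.isCompact_sublevel _ h0).image hi).isClosed

end Extension

/-- The pullback of a nonnegative continuous function on a compact space to a bounded continuous
function. -/
def pullback {K : Type*} [TopologicalSpace K] [CompactSpace K] (i : C(X, K))
    (f : C(K, ℝ≥0)) : BoundedContinuousFunction X ℝ :=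
  (BoundedContinuousFunction.mkOfCompact
    (⟨fun k => (f k : ℝ), by fun_prop⟩ : C(K, ℝ))).compContinuous i

variable [T2Space X]

variable (ψ) in
/-- The inclusion of `C_b(X)` into its closure in `B^ψ(X)`. -/
def boundedToControlled : BoundedContinuousFunction X ℝ →ₗ[ℝ] ψ.controlledGrowth :=
  ψ.ofBoundedContinuous.codRestrict ψ.controlledGrowth fun g =>
    subset_closure (LinearMap.mem_range_self _ g)

theorem exists_tendsto_boundedToControlled (f : ψ.controlledGrowth) :
    ∃ u : ℕ → BoundedContinuousFunction X ℝ,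
      Tendsto (fun n => ψ.boundedToControlled (u n)) atTop (𝓝 f) := by
  have hf : (f : WeightedBounded ψ) ∈
      closure (LinearMap.range ψ.ofBoundedContinuous : Set (WeightedBounded ψ)) := f.2
  obtain ⟨v, hv, hlim⟩ := mem_closure_iff_seq_limit.1 hf
  choose u hu using hv
  refine ⟨u, tendsto_subtype_rng.2 ?_⟩
  have : (fun n => ((ψ.boundedToControlled (u n) : ψ.controlledGrowth) : WeightedBounded ψ)) = v :=
    funext hu
  rwa [this]

/-- Norm convergence implies pointwise convergence, so f is a pointwise limit of continuous
functions. -/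
theorem measurable_controlledGrowth [MeasurableSpace X] [BorelSpace X] (f : ψ.controlledGrowth) :
    Measurable fun x => f.1 x := by
  obtain ⟨u, hu⟩ := exists_tendsto_boundedToControlled f
  refine measurable_of_tendsto_metrizable (f := fun n x => u n x)
    (fun n => (u n).continuous.measurable) (tendsto_pi_nhds.2 fun x => ?_)
  rw [tendsto_iff_norm_sub_tendsto_zero] at hu ⊢
  have hlim := hu.mul_const (ψ x)
  rw [zero_mul] at hlim
  exact squeeze_zero (fun _ => norm_nonneg _) (fun n =>
    WeightedBounded.abs_apply_le (ψ.boundedToControlled (u n) - f).1 x) hlim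

theorem lowerSemicontinuous (ψ : AdmissibleWeight X) : LowerSemicontinuous fun x => ψ x := by
  rw [lowerSemicontinuous_iff_isClosed_preimage]
  intro R
  rcases le_or_gt R 0 with hR | hR
  · convert isClosed_empty
    exact Set.eq_empty_of_forall_notMem fun x hx => absurd (le_trans hx hR) (not_le.2 (ψ.pos x))
  · exact (ψ.isCompact_sublevel R hR).isClosed

section Compactification

variable {K : Type*} [TopologicalSpace K] [CompactSpace K] {i : C(X, K)}

/-- The functional on `C(K, ℝ≥0)` induced by a functional on the weighted space. -/
def pullbackFunctional (ℓ : ψ.controlledGrowth →L[ℝ] ℝ) (i : C(X, K)) : C(K, ℝ≥0) →ₗ[ℝ≥0] ℝ where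
  toFun f := ℓ (ψ.boundedToControlled (pullback i f))
  map_add' f g := by
    rw [← map_add, ← map_add]
    rfl
  map_smul' c f := by
    have : pullback i (c • f) = (c : ℝ) • pullback i f := rfl
    rw [this, map_smul, map_smul]
    rfl

variable (ℓ : ψ.controlledGrowth →L[ℝ] ℝ)

theorem pullbackFunctional_sub_le {f g g' : C(K, ℝ≥0)} {c : ℝ} (hc : 0 ≤ c)
    (hf : ∀ x, (f (i x) : ℝ) ≤ c * ψ x) (hg : g ≤ f) (hg' : g' ≤ f) :
    pullbackFunctional ℓ i g - pullbackFunctional ℓ i g' ≤ ‖ℓ‖ * c := by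
  change ℓ _ - ℓ _ ≤ _
  rw [← map_sub, ← map_sub]
  refine (le_abs_self _).trans ((ℓ.le_opNorm _).trans ?_)
  gcongr
  refine WeightedBounded.norm_le_of_forall_abs_le hc fun x => ?_
  change |(g (i x) : ℝ) - g' (i x)| ≤ _
  have h1 : (g (i x) : ℝ) ≤ f (i x) := hg (i x)
  have h2 : (g' (i x) : ℝ) ≤ f (i x) := hg' (i x)
  have h3 := hf x
  rw [abs_le]
  constructor <;> linarith [(g (i x)).coe_nonneg, (g' (i x)).coe_nonneg]

/-- Since ψ is bounded away from zero, every bounded function lies below a multiple of ψ. -/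
theorem orderBoundedAbove_pullbackFunctional : OrderBoundedAbove (pullbackFunctional ℓ i) := by
  intro f
  obtain ⟨c, hc, hψ⟩ := ψ.exists_pos_le
  refine ⟨‖ℓ‖ * (‖pullback i f‖ * c⁻¹), ?_⟩
  rintro _ ⟨g, hg, rfl⟩
  have := pullbackFunctional_sub_le ℓ (i := i) (f := f) (c := ‖pullback i f‖ * c⁻¹)
    (by positivity) (fun x => ?_) hg (zero_le_continuousMap_nnreal f)
  · simpa using this
  · refine ((le_abs_self _).trans ((pullback i f).norm_coe_le_norm x)).trans ?_
    rw [mul_assoc]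
    refine le_mul_of_one_le_right (norm_nonneg _) ?_
    rw [inv_mul_eq_div, one_le_div₀ hc]
    exact hψ x

/-- A functional on the weighted space is represented, after pullback, by a difference of two
regular measures on the compactification, whose sum integrates the extended weight. -/
theorem exists_regular_pair [T2Space K] [MeasurableSpace K] [BorelSpace K]
    (hi : Function.Injective i) :
    ∃ ν₁ ν₂ : Measure K, ν₁.Regular ∧ ν₂.Regular ∧ IsFiniteMeasure ν₁ ∧ IsFiniteMeasure ν₂ ∧
      (∀ f : C(K, ℝ≥0), ℓ (ψ.boundedToControlled (pullback i f)) =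
        (∫⁻ k, f k ∂ν₁).toReal - (∫⁻ k, f k ∂ν₂).toReal) ∧
      ∫⁻ k, ψ.extendTop i k ∂(ν₁ + ν₂) ≤ ENNReal.ofReal ‖ℓ‖ := by
  have hT : OrderBoundedAbove (pullbackFunctional ℓ i) := orderBoundedAbove_pullbackFunctional ℓ
  have hT' : OrderBoundedAbove (-pullbackFunctional ℓ i) :=
    orderBoundedAbove_pullbackFunctional (-ℓ)
  obtain ⟨ν₁, hr₁, hf₁, h₁⟩ := exists_regular_lintegral_eq hT.posPart
  obtain ⟨ν₂, hr₂, hf₂, h₂⟩ := exists_regular_lintegral_eq hT'.posPart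
  refine ⟨ν₁, ν₂, hr₁, hr₂, hf₁, hf₂, fun f => ?_, ?_⟩
  · rw [h₁, h₂, ENNReal.coe_toReal, ENNReal.coe_toReal, hT.coe_posPart, hT'.coe_posPart,
      intervalSup_sub_intervalSup_neg hT hT']
    rfl
  · refine lintegral_le_of_forall_continuous_le (lowerSemicontinuous_extendTop i.continuous hi)
      (extendTop_pos hi) fun f hf => ?_
    rw [lintegral_add_measure, h₁, h₂, ← ENNReal.coe_add, ENNReal.ofReal]
    refine ENNReal.coe_le_coe.2 (NNReal.le_toNNReal_of_coe_le ?_)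
    rw [NNReal.coe_add, hT.coe_posPart, hT'.coe_posPart]
    refine intervalSup_add_intervalSup_neg_le fun g hg g' hg' => ?_
    have hfψ : ∀ x, (f (i x) : ℝ) ≤ 1 * ψ x := fun x => by
      have := hf (i x)
      rw [extendTop_apply hi,
        ENNReal.le_ofReal_iff_toReal_le ENNReal.coe_ne_top (ψ.pos x).le] at this
      simpa using this
    simpa using pullbackFunctional_sub_le ℓ zero_le_one hfψ hg hg'

end Compactification

/-! ### Descent from βX to X -/

/-- Representation of a functional on the weighted space by a difference of two Radon measures,
on nonnegative bounded continuous functions. -/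
theorem exists_innerRegular_pair {X : Type*} [TopologicalSpace X] [T35Space X] [MeasurableSpace X]
    [BorelSpace X] {ψ : AdmissibleWeight X} (ℓ : ψ.controlledGrowth →L[ℝ] ℝ) :
    ∃ μ₁ μ₂ : Measure X, μ₁.InnerRegular ∧ μ₂.InnerRegular ∧
      IsFiniteMeasure μ₁ ∧ IsFiniteMeasure μ₂ ∧
      (∀ g : BoundedContinuousFunction X ℝ, 0 ≤ g →
        ℓ (ψ.boundedToControlled g) = ∫ x, g x ∂μ₁ - ∫ x, g x ∂μ₂) ∧
      ∫⁻ x, ENNReal.ofReal (ψ x) ∂(μ₁ + μ₂) ≤ ENNReal.ofReal ‖ℓ‖ := by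
  borelize (StoneCech X)
  let i : C(X, StoneCech X) := ⟨stoneCechUnit, continuous_stoneCechUnit⟩
  have hi : IsEmbedding i := isEmbedding_stoneCechUnit
  obtain ⟨ν₁, ν₂, hr₁, hr₂, hf₁, hf₂, hℓ, hψ⟩ := exists_regular_pair ℓ hi.injective
  have hmeas : Measurable (ψ.extendTop i) :=
    (lowerSemicontinuous_extendTop i.continuous hi.injective).measurable
  have hrange := range_eq_extendTop_lt_top (ψ := ψ) hi.injective
  have hr : MeasurableSet (range i) := hrange ▸ measurableSet_lt hmeas measurable_const
  have hme := hi.measurableEmbedding hr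
  have hae : ∀ᵐ k ∂(ν₁ + ν₂), k ∈ range i := by
    rw [hrange]
    exact ae_lt_top hmeas (hψ.trans_lt ENNReal.ofReal_lt_top).ne
  have hmap : ∀ ν ≤ ν₁ + ν₂, (ν.comap i).map i = ν := fun ν hν => by
    rw [hme.map_comap, Measure.restrict_eq_self_of_ae_mem]
    exact (Measure.absolutelyContinuous_of_le hν).ae_le hae
  have hint : ∀ ν ≤ ν₁ + ν₂, ∀ F : StoneCech X → ℝ≥0∞,
      ∫⁻ x, F (i x) ∂(ν.comap i) = ∫⁻ k, F k ∂ν := fun ν hν F => by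
    rw [← hme.lintegral_map, hmap ν hν]
  have hle₁ : ν₁ ≤ ν₁ + ν₂ := Measure.le_add_right le_rfl
  have hle₂ : ν₂ ≤ ν₁ + ν₂ := Measure.le_add_left le_rfl
  refine ⟨ν₁.comap i, ν₂.comap i, hi.innerRegular_comap hr _, hi.innerRegular_comap hr _,
    inferInstance, inferInstance, fun g hg => ?_, ?_⟩
  -- Restricting the codomain to a compact interval lets g extend to βX.
  · let r : X → Icc (0 : ℝ) ‖g‖ := fun x =>
      ⟨g x, hg x, (le_abs_self _).trans (g.norm_coe_le_norm x)⟩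
    have hrc : Continuous r := by fun_prop
    let e : StoneCech X → Icc (0 : ℝ) ‖g‖ := stoneCechExtend hrc
    let f : C(StoneCech X, ℝ≥0) :=
      ⟨fun k => ⟨e k, (e k).2.1⟩,
        (continuous_subtype_val.comp (continuous_stoneCechExtend hrc)).subtype_mk _⟩
    have hf : ∀ x, (f (i x) : ℝ) = g x := fun x =>
      congrArg Subtype.val (stoneCechExtend_stoneCechUnit hrc x)
    have hfg : pullback i f = g := BoundedContinuousFunction.ext hf
    have heq : ∀ ν ≤ ν₁ + ν₂, ∫ x, g x ∂(ν.comap i) = (∫⁻ k, f k ∂ν).toReal := fun ν hν => by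
      rw [← hint ν hν, integral_eq_lintegral_of_nonneg_ae (f := fun x => g x)
        (.of_forall fun x => hg x)
        g.continuous.aestronglyMeasurable]
      congr 2 with x
      rw [← hf x, ENNReal.ofReal_coe_nnreal]
    rw [heq _ hle₁, heq _ hle₂, ← hℓ, hfg]
  · rw [lintegral_add_measure] at hψ ⊢
    rw [← hint _ hle₁, ← hint _ hle₂] at hψ
    simpa only [extendTop_apply hi.injective] using hψ

end AdmissibleWeight

/-! ### The signed measure and the norm identity -/

/-- The integral of a real function against a difference of finite measures. -/
theorem integral_toSignedMeasure_sub {X : Type*} [MeasurableSpace X] {μ₁ μ₂ : Measure X}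
    [IsFiniteMeasure μ₁] [IsFiniteMeasure μ₂] {f : X → ℝ} (h₁ : Integrable f μ₁)
    (h₂ : Integrable f μ₂) :
    ∫ᵛ x, f x ∂•(μ₁.toSignedMeasure - μ₂.toSignedMeasure) = ∫ x, f x ∂μ₁ - ∫ x, f x ∂μ₂ := by
  have hflip : ContinuousLinearMap.lsmul ℝ ℝ = (ContinuousLinearMap.lsmul ℝ ℝ (E := ℝ)).flip := by
    ext
    simp
  rw [hflip, VectorMeasure.integral_sub_vectorMeasure, VectorMeasure.integral_toSignedMeasure,
    VectorMeasure.integral_toSignedMeasure]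
  · rwa [VectorMeasure.Integrable, Measure.variation_toSignedMeasure]
  · rwa [VectorMeasure.Integrable, Measure.variation_toSignedMeasure]

theorem theorem1 {X : Type*} [TopologicalSpace X] [T35Space X] [MeasurableSpace X] [BorelSpace X]
    (ψ : AdmissibleWeight X) (ℓ : ψ.controlledGrowth →L[ℝ] ℝ) :
    ∃ μ : SignedMeasure X, IsSignedRadon μ ∧
      (∀ f : ψ.controlledGrowth,
        Integrable (fun x => f.1 x) μ.totalVariation ∧ ℓ f = ∫ᵛ x, f.1 x ∂•μ) ∧
      Integrable (fun x => ψ x) μ.totalVariation ∧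
      ∫ x, ψ x ∂μ.totalVariation = ‖ℓ‖ := by
  obtain ⟨μ₁, μ₂, hr₁, hr₂, hf₁, hf₂, hℓ, hψ⟩ := AdmissibleWeight.exists_innerRegular_pair ℓ
  set μ : SignedMeasure X := μ₁.toSignedMeasure - μ₂.toSignedMeasure with hμ
  have htv : μ.totalVariation = μ.variation := μ.totalVariation_eq_variation
  have hle : μ.totalVariation ≤ μ₁ + μ₂ := by
    rw [htv, hμ]
    refine VectorMeasure.variation_sub_le.trans ?_
    rw [Measure.variation_toSignedMeasure, Measure.variation_toSignedMeasure]
  have hψm : Measurable fun x => ψ x := ψ.lowerSemicontinuous.measurable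
  have hψsum : Integrable (fun x => ψ x) (μ₁ + μ₂) := by
    refine ⟨hψm.aestronglyMeasurable, ?_⟩
    rw [hasFiniteIntegral_iff_ofReal (.of_forall fun x => (ψ.pos x).le)]
    exact hψ.trans_lt ENNReal.ofReal_lt_top
  have hψint : Integrable (fun x => ψ x) μ.totalVariation := hψsum.mono_measure hle
  have hcint : ∀ (f : ψ.controlledGrowth) (m : Measure X), Integrable (fun x => ψ x) m →
      Integrable (fun x => f.1 x) m := fun f m hm =>
    (hm.const_mul ‖f‖).mono' (AdmissibleWeight.measurable_controlledGrowth f).aestronglyMeasurable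
      (.of_forall fun x => f.1.abs_apply_le x)
  have hint : ∀ f : ψ.controlledGrowth, μ.Integrable fun x => f.1 x := fun f => by
    rw [VectorMeasure.Integrable, ← htv]
    exact hcint f _ hψint
  have hbound : ∀ f : ψ.controlledGrowth,
      ‖∫ᵛ x, f.1 x ∂•μ‖ ≤ (∫ x, ψ x ∂μ.totalVariation) * ‖f‖ := fun f => by
    refine VectorMeasure.norm_integral_le_integral_norm.trans ?_
    rw [← htv]
    refine (mul_le_of_le_one_left (integral_nonneg fun _ => norm_nonneg _)
      ContinuousLinearMap.opNorm_lsmul_le).trans ?_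
    rw [mul_comm, ← integral_const_mul]
    exact integral_mono (hcint f _ hψint).norm (hψint.const_mul _) fun x => f.1.abs_apply_le x
  let J : ψ.controlledGrowth →L[ℝ] ℝ := LinearMap.mkContinuous
    { toFun := fun f => ∫ᵛ x, f.1 x ∂•μ
      map_add' := fun f g => VectorMeasure.integral_fun_add (hint f) (hint g)
      map_smul' := fun c f => VectorMeasure.integral_fun_smul _ _ c _ } _ hbound
  have hnonneg : ∀ g : BoundedContinuousFunction X ℝ, 0 ≤ g →
      ℓ (ψ.boundedToControlled g) = J (ψ.boundedToControlled g) := fun g hg => by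
    have h := integrable_add_measure.1 (hcint (ψ.boundedToControlled g) _ hψsum)
    exact (hℓ g hg).trans (integral_toSignedMeasure_sub h.1 h.2).symm
  have hbdd : ∀ g : BoundedContinuousFunction X ℝ,
      ℓ (ψ.boundedToControlled g) = J (ψ.boundedToControlled g) := fun g => by
    -- Adding the constant ‖g‖ reduces to nonnegative functions.
    let c : BoundedContinuousFunction X ℝ := BoundedContinuousFunction.const X ‖g‖
    have hc : 0 ≤ c := fun x => norm_nonneg g
    have hgc : 0 ≤ g + c := fun x => by
      have : -‖g‖ ≤ g x := (abs_le.1 (g.norm_coe_le_norm x)).1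
      change 0 ≤ g x + ‖g‖
      linarith
    have := hnonneg _ hgc
    rwa [map_add, map_add, map_add, hnonneg c hc, add_left_inj] at this
  have hJ : ∀ f, ℓ f = J f := fun f => by
    obtain ⟨u, hu⟩ := AdmissibleWeight.exists_tendsto_boundedToControlled f
    refine tendsto_nhds_unique ((ℓ.continuous.tendsto f).comp hu) ?_
    refine ((J.continuous.tendsto f).comp hu).congr fun n => (hbdd (u n)).symm
  have hψ0 : 0 ≤ ∫ x, ψ x ∂μ.totalVariation := integral_nonneg fun x => (ψ.pos x).le
  refine ⟨μ, ?_, fun f => ⟨hcint f _ hψint, hJ f⟩, hψint, le_antisymm ?_ ?_⟩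
  · exact Measure.InnerRegular.of_le hle
  · refine (integral_mono_measure hle (.of_forall fun x => (ψ.pos x).le) hψsum).trans ?_
    rw [integral_eq_lintegral_of_nonneg_ae (.of_forall fun x => (ψ.pos x).le)
      hψm.aestronglyMeasurable]
    exact ENNReal.toReal_le_of_le_ofReal ℓ.opNorm_nonneg hψ
  · exact ℓ.opNorm_le_bound hψ0 fun f => by
      rw [hJ f]
      exact hbound f

end
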